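/- Let $H_e$ be a Hermitian $d\times d$ matrix, let $P_1,\dots,P_n$ ($n\ge 1$) be unitary $d\times d$ matrices, and let $\tau_1,\dots,\tau_{n-1}\ge 0$. Put $T=\sum_{i=1}^{n-1}\tau_i$ and $$U=P_1e^{-i\tau_1H_e}P_2e^{-i\tau_2H_e}\cdots P_{n-1}e^{-i\tau_{n-1}H_e}P_n ,$$ the propagator of the sequence of ideal (zero-width) pulses $P_1,\dots,P_n$ separated by free evolutions under $H_e$ of durations $\tau_i$. Then there is a Hermitian $d\times d$ matrix $H_e'$ such that $$U=e^{-iTH_e'}\,P_1P_2\cdots P_n\qquad\text{and}\qquad \Vert H_e'\Vert\le\Vert H_e\Vert$$ for all unitarily invariant norms $\Vert\cdot\Vert$ simultaneously. Here a unitarily invariant norm is understood in the broad sense of a real-valued function on Hermitian matrices with $\Vert A+B\Vert\le\Vert A\Vert+\Vert B\Vert$, $\Vert tA\Vert=t\Vert A\Vert$ for real $t\ge 0$, and $\Vert VAV^\dagger\Vert=\Vert A\Vert$ for unitary $V$. This covers all norms on matrices that are invariant under unitary conjugation, the difference between the largest and the smallest eigenvalue, and the largest eigenvalue. -/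

import Mathlib

/-- The propagator `P₁ e^{-iτ₁H} P₂ e^{-iτ₂H} ⋯ Pₘ e^{-iτₘH} Pₘ₊₁` of a sequence of `m + 1`
instantaneous pulses separated by `m` free evolutions of durations `τ₁, …, τₘ` under the
Hamiltonian `H`. -/
noncomputable def pulsePropagator {d : Type*} [Fintype d] [DecidableEq d] {m : ℕ}
    (P : Fin (m + 1) → Matrix d d ℂ) (τ : Fin m → ℝ) (H : Matrix d d ℂ) : Matrix d d ℂ :=
  (List.ofFn fun i : Fin m =>
    P i.castSucc * NormedSpace.exp ((-(Complex.I * (τ i : ℂ))) • H)).prod * P (Fin.last m)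

/-- The ideal operation `P₁ P₂ ⋯ Pₙ` (product in this order). -/
def idealOperation {d : Type*} [Fintype d] [DecidableEq d] {n : ℕ}
    (P : Fin n → Matrix d d ℂ) : Matrix d d ℂ :=
  (List.ofFn P).prod

/-- Unitarily invariant norms of Hermitian matrices, in the broad sense: functions that on
Hermitian matrices are subadditive, positively homogeneous and invariant under `A ↦ U A U†`.
Neither definiteness nor `N (-A) = N A` is required. So every norm with `N (U A V) = N A`, or only
`N (U A U†) = N A`, is an instance, and so are the difference between the largest and the smallest
eigenvalue (which vanishes on scalar matrices) and the largest eigenvalue (which is positive on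
nonzero traceless Hermitian matrices, but not symmetric). -/
structure IsUnitarilyInvariantNorm {d : Type*} [Fintype d] [DecidableEq d]
    (N : Matrix d d ℂ → ℝ) : Prop where
  add_le : ∀ A B : Matrix d d ℂ, A.IsHermitian → B.IsHermitian → N (A + B) ≤ N A + N B
  smul_eq : ∀ (t : ℝ) (A : Matrix d d ℂ), 0 ≤ t → A.IsHermitian → N ((t : ℂ) • A) = t * N A
  conj_eq : ∀ U A : Matrix d d ℂ, U ∈ Matrix.unitaryGroup d ℂ → A.IsHermitian →
    N (U * A * U.conjTranspose) = N A

/-! Write `H = Q diag(l) Q†`. If `H'` has eigenvalues `y` in the convex hull of the rearrangements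
of `l`, then `N H' ≤ N H` for every invariant `N`, because `z ↦ N (diag z)` is convex and
permutation invariant (`IsUnitarilyInvariantNorm.conj_diagonal_le`).

Moving each pulse to the right by conjugation reduces the theorem to one evolution step,
`exists_exp_mul_phaseConj_eq`: multiplying by `exp(-iτH)` a unitary with phases `t y` gives phases
`(t + τ) y'`, with `y'` still in the hull. A principal logarithm is not enough, since total phases
may exceed `π`; the real phases are followed in time. Their velocities are the diagonal of `H` in an
eigenbasis of the current unitary (`exists_phase_velocity`), and by Schur's theorem this diagonal
lies in the hull. Averaging velocities over time stays in the hull by convexity. -/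

open Matrix Filter Topology

/-! ### Unitary matrices and their eigenphases -/

section

variable {d : Type*} [Fintype d] [DecidableEq d]

/-- The matrix `V diag(e^{-i x}) V†`. -/
noncomputable def phaseConj (V : Matrix d d ℂ) (x : d → ℝ) : Matrix d d ℂ :=
  V * diagonal (fun k => Complex.exp (-(Complex.I * (x k : ℂ)))) * Vᴴ

theorem mul_conjTranspose_of_mem_unitaryGroup {V : Matrix d d ℂ} (hV : V ∈ unitaryGroup d ℂ) :
    V * Vᴴ = 1 :=
  mem_unitaryGroup_iff.1 hV

theorem conjTranspose_mul_of_mem_unitaryGroup {V : Matrix d d ℂ} (hV : V ∈ unitaryGroup d ℂ) :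
    Vᴴ * V = 1 :=
  mem_unitaryGroup_iff'.1 hV

theorem conjTranspose_mem_unitaryGroup {V : Matrix d d ℂ} (hV : V ∈ unitaryGroup d ℂ) :
    Vᴴ ∈ unitaryGroup d ℂ := by
  rw [mem_unitaryGroup_iff, star_eq_conjTranspose, conjTranspose_conjTranspose]
  exact conjTranspose_mul_of_mem_unitaryGroup hV

theorem diagonal_exp_mem_unitaryGroup (x : d → ℝ) :
    diagonal (fun k => Complex.exp (-(Complex.I * (x k : ℂ)))) ∈ unitaryGroup d ℂ := by
  rw [mem_unitaryGroup_iff, star_eq_conjTranspose, diagonal_conjTranspose, diagonal_mul_diagonal,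
    ← diagonal_one]
  congr 1
  funext k
  simp only [Pi.star_apply, RCLike.star_def, ← Complex.exp_conj, ← Complex.exp_add]
  simp

theorem phaseConj_mem_unitaryGroup {V : Matrix d d ℂ} (hV : V ∈ unitaryGroup d ℂ) (x : d → ℝ) :
    phaseConj V x ∈ unitaryGroup d ℂ :=
  mul_mem (mul_mem hV (diagonal_exp_mem_unitaryGroup x)) (conjTranspose_mem_unitaryGroup hV)

theorem exp_smul_conj_diagonal {V : Matrix d d ℂ} (hV : V ∈ unitaryGroup d ℂ) (c : ℂ)
    (y : d → ℝ) :
    NormedSpace.exp (c • (V * diagonal (fun k => (y k : ℂ)) * Vᴴ)) =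
      V * diagonal (fun k => Complex.exp (c * y k)) * Vᴴ := by
  have hinv : V⁻¹ = Vᴴ := inv_eq_left_inv (conjTranspose_mul_of_mem_unitaryGroup hV)
  have hu : IsUnit V := IsUnit.of_mul_eq_one _ (mul_conjTranspose_of_mem_unitaryGroup hV)
  have h1 : c • (V * diagonal (fun k => (y k : ℂ)) * Vᴴ)
      = V * diagonal (fun k => c * (y k : ℂ)) * V⁻¹ := by
    rw [hinv, ← Matrix.smul_mul, ← Matrix.mul_smul, ← diagonal_smul]
    rfl
  rw [h1, exp_conj _ _ hu, exp_diagonal, hinv]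
  congr 3
  funext k
  rw [Pi.coe_exp, Complex.exp_eq_exp_ℂ]

theorem exp_smul_conj_diagonal_eq_phaseConj {V : Matrix d d ℂ} (hV : V ∈ unitaryGroup d ℂ)
    (t : ℝ) (y : d → ℝ) :
    NormedSpace.exp ((-(Complex.I * (t : ℂ))) • (V * diagonal (fun k => (y k : ℂ)) * Vᴴ)) =
      phaseConj V (fun k => t * y k) := by
  rw [exp_smul_conj_diagonal hV, phaseConj]
  congr 3
  funext k
  congr 1
  push_cast
  ring

theorem IsHermitian.eq_conj_diagonal {A : Matrix d d ℂ} (hA : A.IsHermitian) :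
    A = (hA.eigenvectorUnitary : Matrix d d ℂ) * diagonal (fun k => (hA.eigenvalues k : ℂ)) *
      (hA.eigenvectorUnitary : Matrix d d ℂ)ᴴ := by
  conv_lhs => rw [hA.spectral_theorem, Unitary.conjStarAlgAut_apply]
  rfl

theorem exp_mem_unitaryGroup {A : Matrix d d ℂ} (hA : A.IsHermitian) (t : ℝ) :
    NormedSpace.exp ((-(Complex.I * (t : ℂ))) • A) ∈ unitaryGroup d ℂ := by
  rw [IsHermitian.eq_conj_diagonal hA,
    exp_smul_conj_diagonal_eq_phaseConj hA.eigenvectorUnitary.2]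
  exact phaseConj_mem_unitaryGroup hA.eigenvectorUnitary.2 _

-- Functional calculus with `-arg`: its discontinuity is harmless because the spectrum is finite.
open scoped Matrix.Norms.L2Operator in
theorem exists_isHermitian_exp_eq {W : Matrix d d ℂ} (hW : W ∈ unitaryGroup d ℂ) :
    ∃ B : Matrix d d ℂ, B.IsHermitian ∧ NormedSpace.exp ((-Complex.I) • B) = W := by
  have hn : IsStarNormal W := ⟨by
    rw [commute_iff_eq, mem_unitaryGroup_iff.1 hW, mem_unitaryGroup_iff'.1 hW]⟩
  have hfin : (spectrum ℂ W).Finite := Matrix.finite_spectrum W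
  have hc : ∀ f : ℂ → ℂ, ContinuousOn f (spectrum ℂ W) := fun f => hfin.continuousOn f
  have hunit : ∀ z ∈ spectrum ℂ W, ‖z‖ = 1 := fun z hz => by
    simpa using spectrum.subset_circle_of_unitary (𝕜 := ℂ) hW hz
  refine ⟨cfc (fun z : ℂ => (-(Complex.arg z : ℝ) : ℂ)) W, ?_, ?_⟩
  · have : IsSelfAdjoint (cfc (fun z : ℂ => (-(Complex.arg z : ℝ) : ℂ)) W) := by
      rw [IsSelfAdjoint, ← cfc_star]
      congr 1
      funext z
      simp
    exact this
  · rw [← cfc_smul _ _ _ (hc _), ← CFC.complex_exp_eq_normedSpace_exp (cfc_predicate _ _),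
      ← cfc_comp' Complex.exp _ W (by fun_prop) (hc _)]
    conv_rhs => rw [← cfc_id ℂ W]
    refine cfc_congr fun z hz => ?_
    have := Complex.norm_mul_exp_arg_mul_I z
    rw [hunit z hz] at this
    simp only [smul_eq_mul, id]
    refine Eq.trans ?_ this
    simp [mul_comm]

theorem exists_eq_phaseConj {W : Matrix d d ℂ} (hW : W ∈ unitaryGroup d ℂ) :
    ∃ V ∈ unitaryGroup d ℂ, ∃ x : d → ℝ, W = phaseConj V x := by
  obtain ⟨B, hB, rfl⟩ := exists_isHermitian_exp_eq hW
  refine ⟨_, hB.eigenvectorUnitary.2, hB.eigenvalues, ?_⟩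
  conv_lhs => rw [IsHermitian.eq_conj_diagonal hB]
  simpa using exp_smul_conj_diagonal_eq_phaseConj hB.eigenvectorUnitary.2 1 hB.eigenvalues

theorem isCompact_unitaryGroup :
    IsCompact {V : Matrix d d ℂ | V ∈ unitaryGroup d ℂ} := by
  have hcl : IsClosed {V : Matrix d d ℂ | V ∈ unitaryGroup d ℂ} := by
    simp only [mem_unitaryGroup_iff]
    exact isClosed_eq (by fun_prop) continuous_const
  have hK : IsCompact (Set.univ.pi fun _ : d => Set.univ.pi fun _ : d =>
      Metric.closedBall (0 : ℂ) 1) :=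
    isCompact_univ_pi fun _ => isCompact_univ_pi fun _ => isCompact_closedBall _ _
  refine hK.of_isClosed_subset hcl fun V hV i _ j _ => ?_
  simpa using entry_norm_bound_of_unitary hV i j

theorem exists_perm_of_multiset_map_eq {α β : Type*} [Fintype α] [DecidableEq β] {f g : α → β}
    (h : Finset.univ.val.map f = Finset.univ.val.map g) : ∃ σ : Equiv.Perm α, f = g ∘ σ := by
  have hcard : ∀ b, Nonempty ({a // f a = b} ≃ {a // g a = b}) := fun b => by
    rw [← Fintype.card_eq, Fintype.card_subtype, Fintype.card_subtype]
    have := congrArg (Multiset.count b) h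
    rw [Multiset.count_map, Multiset.count_map] at this
    simpa [Finset.card, Finset.filter_val, eq_comm] using this
  refine ⟨Equiv.ofFiberEquiv fun b => (hcard b).some, funext fun a => ?_⟩
  exact (Equiv.ofFiberEquiv_map _ a).symm

theorem exists_perm_of_conj_diagonal_eq {V U : Matrix d d ℂ} (hV : V ∈ unitaryGroup d ℂ)
    (hU : U ∈ unitaryGroup d ℂ) {e f : d → ℂ}
    (h : U * diagonal e * Uᴴ = V * diagonal f * Vᴴ) : ∃ σ : Equiv.Perm d, e = f ∘ σ := by
  have key : ∀ {Q : Matrix d d ℂ}, Q ∈ unitaryGroup d ℂ → ∀ g : d → ℂ,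
      (Q * diagonal g * Qᴴ).charpoly.roots = Finset.univ.val.map g := fun {Q} hQ g => by
    rw [charpoly_mul_comm, ← mul_assoc, conjTranspose_mul_of_mem_unitaryGroup hQ, one_mul,
      charpoly_diagonal, Polynomial.roots_prod]
    · simp
    · simp [Finset.prod_ne_zero_iff, Polynomial.X_sub_C_ne_zero]
  exact exists_perm_of_multiset_map_eq (by rw [← key hU e, h, key hV f])

/-! ### First-order motion of eigenphases -/

open scoped Matrix.Norms.L2Operator in
theorem tendsto_inv_smul_exp_sub_one (A : Matrix d d ℂ) :
    Tendsto (fun δ : ℝ => ((δ : ℂ)⁻¹) • (NormedSpace.exp ((-(Complex.I * (δ : ℂ))) • A) - 1))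
      (𝓝[≠] 0) (𝓝 ((-Complex.I) • A)) := by
  have h := hasDerivAt_exp_smul_const (𝕂 := ℝ) ((-Complex.I) • A) (0 : ℝ)
  rw [hasDerivAt_iff_tendsto_slope] at h
  simp only [zero_smul, NormedSpace.exp_zero, one_mul] at h
  refine h.congr fun δ => ?_
  rw [slope_def_module, sub_zero, zero_smul, NormedSpace.exp_zero]
  have : δ • (-Complex.I) • A = (-(Complex.I * (δ : ℂ))) • A := by
    rw [← Complex.coe_smul, smul_smul]
    congr 1
    ring
  rw [this, ← Complex.coe_smul, Complex.ofReal_inv]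

/-- Since `log' 1 = 1`, `log z` agrees with `z - 1` to first order; `dslope` also covers the terms
with `z n = 1`. -/
theorem tendsto_log_div {z : ℕ → ℂ} {δ : ℕ → ℂ} {c : ℂ} (hz : Tendsto z atTop (𝓝 1))
    (h : Tendsto (fun n => (δ n)⁻¹ * (z n - 1)) atTop (𝓝 c)) :
    Tendsto (fun n => (δ n)⁻¹ * Complex.log (z n)) atTop (𝓝 c) := by
  have hd : HasDerivAt Complex.log 1 1 := by
    simpa using Complex.hasDerivAt_log Complex.one_mem_slitPlane
  have hc : Tendsto (dslope Complex.log 1) (𝓝 1) (𝓝 1) := by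
    have := (continuousAt_dslope_same.2 hd.differentiableAt).tendsto
    rwa [dslope_same, hd.deriv] at this
  have := h.mul (hc.comp hz)
  rw [mul_one] at this
  refine this.congr fun n => ?_
  have h1 := sub_smul_dslope Complex.log 1 (z n)
  rw [Complex.log_one, sub_zero, smul_eq_mul] at h1
  rw [← h1, Function.comp_apply, mul_assoc]

/-- Spectral data of a convergent sequence of unitary matrices converge along a subsequence. -/
theorem exists_subseq_tendsto_phaseConj {W : ℕ → Matrix d d ℂ}
    (hW : ∀ n, W n ∈ unitaryGroup d ℂ) {V : Matrix d d ℂ} (hV : V ∈ unitaryGroup d ℂ)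
    (x : d → ℝ) (hlim : Tendsto W atTop (𝓝 (phaseConj V x))) :
    ∃ (φ : ℕ → ℕ) (Q : ℕ → Matrix d d ℂ) (w : ℕ → d → ℝ) (U : Matrix d d ℂ)
      (σ : Equiv.Perm d), StrictMono φ ∧ (∀ n, Q n ∈ unitaryGroup d ℂ) ∧ U ∈ unitaryGroup d ℂ ∧
      (∀ n, W (φ n) = phaseConj (Q n) (w n)) ∧ Tendsto Q atTop (𝓝 U) ∧
      phaseConj V x = phaseConj U (x ∘ σ) ∧
      ∀ k, Tendsto (fun n => Complex.exp (-(Complex.I * (w n k : ℂ)))) atTop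
        (𝓝 (Complex.exp (-(Complex.I * (x (σ k) : ℂ))))) := by
  choose Q hQ w hw using fun n => exists_eq_phaseConj (hW n)
  have : FirstCountableTopology (Matrix d d ℂ) :=
    inferInstanceAs (FirstCountableTopology (d → d → ℂ))
  obtain ⟨U, hU, φ, hφ, hQU⟩ := isCompact_unitaryGroup.tendsto_subseq hQ
  have hUm : Uᴴ * U = 1 := conjTranspose_mul_of_mem_unitaryGroup hU
  have hUm' : U * Uᴴ = 1 := mul_conjTranspose_of_mem_unitaryGroup hU
  have hD : Tendsto (fun n => diagonal
      (fun k => Complex.exp (-(Complex.I * (w (φ n) k : ℂ))))) atTop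
      (𝓝 (Uᴴ * phaseConj V x * U)) := by
    have hcont : Continuous fun p : Matrix d d ℂ × Matrix d d ℂ => p.1ᴴ * p.2 * p.1 := by fun_prop
    refine ((hcont.tendsto (U, phaseConj V x)).comp
      (hQU.prodMk_nhds (hlim.comp hφ.tendsto_atTop))).congr fun n => ?_
    have h1 := conjTranspose_mul_of_mem_unitaryGroup (hQ (φ n))
    simp only [Function.comp_apply]
    rw [hw (φ n), phaseConj]
    simp only [mul_assoc, h1, mul_one]
    rw [← mul_assoc, h1, one_mul]
  -- A limit of diagonal matrices is diagonal, so `U` is an eigenbasis of the limit.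
  have hE : Uᴴ * phaseConj V x * U = diagonal (fun k => (Uᴴ * phaseConj V x * U) k k) := by
    refine tendsto_nhds_unique hD ?_
    have hcont : Continuous fun M : Matrix d d ℂ => diagonal (fun k => M k k) := by fun_prop
    refine ((hcont.tendsto _).comp hD).congr fun n => ?_
    simp
  have hUE : phaseConj V x = U * diagonal (fun k => (Uᴴ * phaseConj V x * U) k k) * Uᴴ := by
    rw [← hE]
    simp only [mul_assoc, hUm', mul_one]
    rw [← mul_assoc, hUm', one_mul]
  obtain ⟨σ, hσ⟩ := exists_perm_of_conj_diagonal_eq hV hU (hUE.symm.trans rfl)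
  refine ⟨φ, Q ∘ φ, w ∘ φ, U, σ, hφ, fun n => hQ _, hU, fun n => hw _, hQU, ?_, fun k => ?_⟩
  · conv_lhs => rw [hUE, hσ]
    rfl
  · have hcont : Continuous fun M : Matrix d d ℂ => M k k := by fun_prop
    have := (hcont.tendsto _).comp hD
    rw [congrFun hσ k] at this
    simpa [Function.comp_def] using this

/-- First-order perturbation of the eigenphases of a unitary matrix: along a sequence of arbitrarily
small times `δ`, the eigenphases of `exp(-iδA) W` move with the velocities given by the diagonal of
`A` in some eigenbasis of `W`. -/
theorem exists_phase_velocity {A : Matrix d d ℂ} (hA : A.IsHermitian) {V : Matrix d d ℂ}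
    (hV : V ∈ unitaryGroup d ℂ) (x : d → ℝ) :
    ∃ U ∈ unitaryGroup d ℂ, ∃ σ : Equiv.Perm d, ∀ η : ℝ, 0 < η → ∀ b : ℝ, 0 < b →
      ∃ δ : ℝ, 0 < δ ∧ δ < b ∧ ∃ Q ∈ unitaryGroup d ℂ, ∃ r : d → ℝ, (∀ k, |r k| ≤ η) ∧
        NormedSpace.exp ((-(Complex.I * (δ : ℂ))) • A) * phaseConj V x =
          phaseConj Q (fun k => x (σ k) + δ * (((Uᴴ * A * U) k k).re + r k)) := by
  have hexp : Tendsto (fun δ : ℝ => NormedSpace.exp ((-(Complex.I * (δ : ℂ))) • A))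
      (𝓝[≠] 0) (𝓝 1) := by
    have h1 : Tendsto (fun δ : ℝ => (δ : ℂ)) (𝓝[≠] 0) (𝓝 0) := by
      have : Tendsto (fun δ : ℝ => (δ : ℂ)) (𝓝 0) (𝓝 ((0 : ℝ) : ℂ)) :=
        Complex.continuous_ofReal.tendsto 0
      simpa using this.mono_left nhdsWithin_le_nhds
    have h2 := (h1.smul (tendsto_inv_smul_exp_sub_one A)).add_const 1
    rw [zero_smul, zero_add] at h2
    refine h2.congr' ?_
    filter_upwards [self_mem_nhdsWithin] with δ hδ
    rw [smul_inv_smul₀ (by exact_mod_cast hδ), sub_add_cancel]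
  set δ : ℕ → ℝ := fun n => 1 / ((n : ℝ) + 1) with hδ
  have hδpos : ∀ n, 0 < δ n := fun n => by positivity
  have hδ0 : Tendsto δ atTop (𝓝 0) := tendsto_one_div_add_atTop_nhds_zero_nat
  have hδne : Tendsto δ atTop (𝓝[≠] 0) :=
    tendsto_nhdsWithin_iff.2 ⟨hδ0, Eventually.of_forall fun n => (hδpos n).ne'⟩
  obtain ⟨φ, Q, w, U, σ, hφ, hQ, hU, hw, hQU, hVU, hwx⟩ :=
    exists_subseq_tendsto_phaseConj
      (W := fun n => NormedSpace.exp ((-(Complex.I * (δ n : ℂ))) • A) * phaseConj V x)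
      (fun n => mul_mem (exp_mem_unitaryGroup hA _) (phaseConj_mem_unitaryGroup hV x)) hV x
      (by simpa using (hexp.comp hδne).mul_const (phaseConj V x))
  have hUm : Uᴴ * U = 1 := conjTranspose_mul_of_mem_unitaryGroup hU
  have hδφ := hδne.comp hφ.tendsto_atTop
  set e : d → ℂ := fun k => Complex.exp (-(Complex.I * (x (σ k) : ℂ))) with he
  have he0 : ∀ k, e k ≠ 0 := fun k => Complex.exp_ne_zero _
  set a : d → ℝ := fun k => ((Uᴴ * A * U) k k).re with ha
  have haC : ∀ k, (Uᴴ * A * U) k k = (a k : ℂ) := fun k => by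
    have hH : (Uᴴ * A * U).IsHermitian := isHermitian_conjTranspose_mul_mul U hA
    exact (hH.coe_re_apply_self k).symm
  have hG : Tendsto (fun n => Uᴴ * Q n) atTop (𝓝 1) := by
    rw [← hUm]
    exact tendsto_const_nhds.mul hQU
  have hGk : ∀ k, Tendsto (fun n => (Uᴴ * Q n) k k) atTop (𝓝 1) := fun k => by
    have hcont : Continuous fun M : Matrix d d ℂ => M k k := by fun_prop
    have := (hcont.tendsto _).comp hG
    rwa [one_apply_eq] at this
  -- Sandwich the difference quotient of `exp(-iδA) W` between the limiting basis `U†` and the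
  -- moving basis `Q n`. Its `k`-th diagonal entry is exactly `(U†Q n) k k` times the difference
  -- quotient of the `k`-th eigenvalue, and `U†Q n → 1`. Degenerate eigenvalues need no separate
  -- treatment, as the sequence itself selects `U`.
  have hkey : ∀ k, Tendsto (fun n => ((δ (φ n) : ℝ) : ℂ)⁻¹ *
      (Complex.exp (-(Complex.I * (w n k : ℂ))) / e k - 1)) atTop (𝓝 (-Complex.I * a k)) := by
    intro k
    have h1 : Tendsto (fun n => Uᴴ * ((((δ (φ n) : ℝ) : ℂ)⁻¹) •
        (NormedSpace.exp ((-(Complex.I * (δ (φ n) : ℂ))) • A) - 1)) * phaseConj V x * Q n) atTop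
        (𝓝 (Uᴴ * ((-Complex.I) • A) * phaseConj V x * U)) :=
      (((tendsto_const_nhds.mul ((tendsto_inv_smul_exp_sub_one A).comp hδφ)).mul_const _).mul hQU)
    have h2 : Uᴴ * ((-Complex.I) • A) * phaseConj V x * U
        = (-Complex.I) • (Uᴴ * A * U * diagonal e) := by
      rw [hVU, phaseConj]
      simp only [mul_assoc, hUm, mul_one, Matrix.smul_mul, Matrix.mul_smul]
      rfl
    have h3 : ∀ n, Uᴴ * ((((δ (φ n) : ℝ) : ℂ)⁻¹) •
        (NormedSpace.exp ((-(Complex.I * (δ (φ n) : ℂ))) • A) - 1)) * phaseConj V x * Q n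
        = (((δ (φ n) : ℝ) : ℂ)⁻¹) •
          (Uᴴ * Q n * diagonal (fun k => Complex.exp (-(Complex.I * (w n k : ℂ))))
            - diagonal e * (Uᴴ * Q n)) := by
      intro n
      have h4 : NormedSpace.exp ((-(Complex.I * (δ (φ n) : ℂ))) • A) * phaseConj V x * Q n
          = Q n * diagonal (fun k => Complex.exp (-(Complex.I * (w n k : ℂ)))) := by
        rw [hw n, phaseConj]
        simp only [mul_assoc, conjTranspose_mul_of_mem_unitaryGroup (hQ n), mul_one]
      have h5 : Uᴴ * phaseConj V x = diagonal e * Uᴴ := by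
        rw [hVU, phaseConj]
        simp only [← mul_assoc, hUm, one_mul]
        rfl
      rw [Matrix.mul_smul, Matrix.smul_mul, Matrix.smul_mul, mul_sub, mul_one, sub_mul, sub_mul,
        h5, mul_assoc Uᴴ, mul_assoc Uᴴ, h4, mul_assoc, mul_assoc]
    have hcont : Continuous fun M : Matrix d d ℂ => M k k := by fun_prop
    have h6 := (hcont.tendsto _).comp h1
    rw [h2] at h6
    have h7 := ((h6.div (hGk k) one_ne_zero).div_const (e k))
    have h8 : (-Complex.I • (Uᴴ * A * U * diagonal e)) k k / 1 / e k = -Complex.I * a k := by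
      rw [Matrix.smul_apply, mul_diagonal, haC, smul_eq_mul, div_one]
      field_simp [he0 k]
    rw [h8] at h7
    refine h7.congr' ?_
    filter_upwards [(hGk k).eventually_ne one_ne_zero] with n hn
    simp only [Function.comp_apply, Pi.div_apply]
    rw [h3, Matrix.smul_apply, Matrix.sub_apply, mul_diagonal, diagonal_mul, smul_eq_mul]
    have := he0 k
    field_simp
  have hratio : ∀ k, Tendsto (fun n => Complex.exp (-(Complex.I * (w n k : ℂ))) / e k) atTop
      (𝓝 1) := fun k => by
    have := (hwx k).div_const (e k)
    rwa [div_self (he0 k)] at this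
  have hlog := fun k => tendsto_log_div (hratio k) (hkey k)
  -- The phases `w` are fixed only modulo `2π`; `θ` is the small representative of the increment
  -- from `x ∘ σ`.
  set θ : ℕ → d → ℝ := fun n k => -(Complex.exp (-(Complex.I * (w n k : ℂ))) / e k).arg with hθ
  have hθlog : ∀ n k, Complex.log (Complex.exp (-(Complex.I * (w n k : ℂ))) / e k)
      = -Complex.I * θ n k := fun n k => by
    have hn : ‖Complex.exp (-(Complex.I * (w n k : ℂ))) / e k‖ = 1 := by
      simp [he, Complex.norm_exp]
    apply Complex.ext
    · rw [Complex.log_re, hn]; simp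
    · rw [Complex.log_im]; simp [hθ]
  have hθlim : ∀ k, Tendsto (fun n => (δ (φ n))⁻¹ * θ n k - a k) atTop (𝓝 0) := fun k => by
    have h1 := (hlog k).const_mul Complex.I
    have h2 := (Complex.continuous_re.tendsto _).comp h1
    have h3 := h2.sub_const (a k)
    have h4 : (Complex.I * (-Complex.I * (a k : ℂ))).re - a k = 0 := by
      rw [← mul_assoc]; simp
    rw [h4] at h3
    refine h3.congr fun n => ?_
    simp only [Function.comp_apply]
    rw [hθlog, mul_left_comm, ← mul_assoc Complex.I, mul_neg, Complex.I_mul_I, neg_neg, one_mul,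
      ← Complex.ofReal_inv, ← Complex.ofReal_mul, Complex.ofReal_re]
  refine ⟨U, hU, σ, fun η hη b hb => ?_⟩
  have hev1 : ∀ᶠ n in atTop, ∀ k, |(δ (φ n))⁻¹ * θ n k - a k| ≤ η :=
    eventually_all.2 fun k => by
      have := (hθlim k).abs
      rw [abs_zero] at this
      exact (this.eventually_lt_const hη).mono fun n hn => hn.le
  have hev2 : ∀ᶠ n in atTop, δ (φ n) < b :=
    (hδ0.comp hφ.tendsto_atTop).eventually_lt_const hb
  obtain ⟨n, hn1, hn2⟩ := (hev1.and hev2).exists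
  refine ⟨δ (φ n), hδpos _, hn2, Q n, hQ n, fun k => (δ (φ n))⁻¹ * θ n k - a k, hn1, ?_⟩
  rw [hw n, phaseConj, phaseConj]
  congr 3
  funext k
  have h1 : Complex.exp (-Complex.I * θ n k) = Complex.exp (-(Complex.I * (w n k : ℂ))) / e k := by
    rw [← hθlog, Complex.exp_log (div_ne_zero (Complex.exp_ne_zero _) (he0 k))]
  rw [eq_div_iff (he0 k)] at h1
  rw [← h1, he, ← Complex.exp_add]
  congr 1
  have h2 : δ (φ n) * (a k + ((δ (φ n))⁻¹ * θ n k - a k)) = θ n k := by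
    have := (hδpos (φ n)).ne'
    field_simp
    ring
  change _ = -(Complex.I * ((x (σ k) + δ (φ n) * (a k + ((δ (φ n))⁻¹ * θ n k - a k)) : ℝ) : ℂ))
  rw [h2]
  push_cast
  ring

end

/-! ### Majorization and invariant norms -/

section

/-- The convex hull of the rearrangements of `l`, i.e. the set of vectors majorized by `l`. -/
def permutahedron {d : Type*} (l : d → ℝ) : Set (d → ℝ) :=
  convexHull ℝ (Set.range fun σ : Equiv.Perm d => l ∘ σ)

theorem self_mem_permutahedron {d : Type*} (l : d → ℝ) : l ∈ permutahedron l :=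
  subset_convexHull ℝ _ ⟨1, rfl⟩

theorem isCompact_permutahedron {d : Type*} [Finite d] (l : d → ℝ) : IsCompact (permutahedron l) :=
  (Set.finite_range _).isCompact_convexHull ℝ

theorem comp_perm_mem_permutahedron {d : Type*} {l y : d → ℝ} (hy : y ∈ permutahedron l)
    (σ : Equiv.Perm d) : y ∘ σ ∈ permutahedron l := by
  have h : LinearMap.funLeft ℝ ℝ σ y ∈ LinearMap.funLeft ℝ ℝ σ '' permutahedron l := ⟨y, hy, rfl⟩
  rw [permutahedron, LinearMap.image_convexHull] at h
  refine convexHull_mono ?_ h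
  rintro _ ⟨_, ⟨τ, rfl⟩, rfl⟩
  exact ⟨σ.trans τ, rfl⟩

variable {d : Type*} [Fintype d] [DecidableEq d]

/-- Birkhoff's theorem, pushed forward by the linear map `S ↦ S *ᵥ l`. -/
theorem mulVec_mem_permutahedron {S : Matrix d d ℝ} (hS : S ∈ doublyStochastic ℝ d) (l : d → ℝ) :
    S *ᵥ l ∈ permutahedron l := by
  have hS' : S ∈ convexHull ℝ {σ.permMatrix ℝ | σ : Equiv.Perm d} := by
    rw [← doublyStochastic_eq_convexHull_permMatrix]; exact hS
  have h : (mulVecBilin ℝ ℝ).flip l S ∈ (mulVecBilin ℝ ℝ).flip l ''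
      convexHull ℝ {σ.permMatrix ℝ | σ : Equiv.Perm d} := ⟨S, hS', rfl⟩
  rw [LinearMap.image_convexHull] at h
  refine convexHull_mono ?_ h
  rintro _ ⟨_, ⟨σ, rfl⟩, rfl⟩
  exact ⟨σ, (permMatrix_mulVec σ).symm⟩

theorem normSq_mem_doublyStochastic {U : Matrix d d ℂ} (hU : U ∈ unitaryGroup d ℂ) :
    Matrix.of (fun i j => Complex.normSq (U i j)) ∈ doublyStochastic ℝ d := by
  rw [mem_doublyStochastic_iff_sum]
  refine ⟨fun i j => Complex.normSq_nonneg _, fun i => ?_, fun j => ?_⟩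
  · have h := congrFun (congrFun (mul_conjTranspose_of_mem_unitaryGroup hU) i) i
    rw [mul_apply, one_apply_eq] at h
    simp only [conjTranspose_apply, RCLike.star_def, Complex.mul_conj] at h
    exact_mod_cast h
  · have h := congrFun (congrFun (conjTranspose_mul_of_mem_unitaryGroup hU) j) j
    rw [mul_apply, one_apply_eq] at h
    simp only [conjTranspose_apply, RCLike.star_def, mul_comm _ (U _ _), Complex.mul_conj] at h
    exact_mod_cast h

/-- Schur's theorem: the diagonal of a Hermitian matrix is majorized by its eigenvalues. -/
theorem re_diag_conj_mem_permutahedron {U Q : Matrix d d ℂ} (hU : U ∈ unitaryGroup d ℂ)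
    (hQ : Q ∈ unitaryGroup d ℂ) (l : d → ℝ) :
    (fun k => ((Uᴴ * (Q * diagonal (fun k => (l k : ℂ)) * Qᴴ) * U) k k).re) ∈
      permutahedron l := by
  have hM : Uᴴ * Q ∈ unitaryGroup d ℂ := mul_mem (conjTranspose_mem_unitaryGroup hU) hQ
  convert mulVec_mem_permutahedron (normSq_mem_doublyStochastic hM) l using 1
  funext k
  have h : Uᴴ * (Q * diagonal (fun k => (l k : ℂ)) * Qᴴ) * U
      = (Uᴴ * Q) * diagonal (fun k => (l k : ℂ)) * (Uᴴ * Q)ᴴ := by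
    simp only [conjTranspose_mul, conjTranspose_conjTranspose, mul_assoc]
  rw [h, mul_apply, Complex.re_sum]
  refine Finset.sum_congr rfl fun j _ => ?_
  change _ = Complex.normSq ((Uᴴ * Q) k j) * l j
  rw [mul_diagonal, conjTranspose_apply, Complex.normSq_apply, RCLike.star_def]
  simp only [Complex.mul_re, Complex.mul_im, Complex.conj_re, Complex.conj_im, Complex.ofReal_re,
    Complex.ofReal_im]
  ring

theorem isHermitian_conj_diagonal (V : Matrix d d ℂ) (y : d → ℝ) :
    (V * diagonal (fun k => (y k : ℂ)) * Vᴴ).IsHermitian :=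
  isHermitian_mul_mul_conjTranspose V
    (isHermitian_diagonal_of_self_adjoint _ (by ext k; simp))

theorem permMatrix_conj_diagonal (σ : Equiv.Perm d) (y : d → ℝ) :
    ∃ R ∈ unitaryGroup d ℂ, R * diagonal (fun k => (y k : ℂ)) * Rᴴ =
      diagonal (fun k => (y (σ k) : ℂ)) := by
  have hR : (σ.permMatrix ℂ) * (σ.permMatrix ℂ)ᴴ = 1 := by
    rw [conjTranspose_permMatrix, ← permMatrix_mul]
    simp
  refine ⟨σ.permMatrix ℂ, mem_unitaryGroup_iff.2 hR, ?_⟩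
  have : σ.permMatrix ℂ * diagonal (fun k => (y k : ℂ))
      = diagonal (fun k => (y (σ k) : ℂ)) * σ.permMatrix ℂ := by
    ext i j
    rw [mul_diagonal, diagonal_mul]
    by_cases h : σ i = j
    · subst h; ring
    · simp [Equiv.Perm.permMatrix, PEquiv.toMatrix_apply, h]
  rw [this, mul_assoc, hR, mul_one]

/-- A convex function at a point of a convex hull is at most its value at some generator; here all
generators `l ∘ σ` give the same value, by conjugation with permutation matrices. -/
theorem IsUnitarilyInvariantNorm.conj_diagonal_le {N : Matrix d d ℂ → ℝ}
    (hN : IsUnitarilyInvariantNorm N) {V Q : Matrix d d ℂ} (hV : V ∈ unitaryGroup d ℂ)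
    (hQ : Q ∈ unitaryGroup d ℂ) {l y : d → ℝ} (hy : y ∈ permutahedron l) :
    N (V * diagonal (fun k => (y k : ℂ)) * Vᴴ) ≤ N (Q * diagonal (fun k => (l k : ℂ)) * Qᴴ) := by
  have hd : ∀ z : d → ℝ, (diagonal (fun k => (z k : ℂ)) : Matrix d d ℂ).IsHermitian := fun z =>
    isHermitian_diagonal_of_self_adjoint _ (by ext k; simp)
  rw [hN.conj_eq V _ hV (hd y), hN.conj_eq Q _ hQ (hd l)]
  have hsmul : ∀ (c : ℝ) (z : d → ℝ), (diagonal (fun k => ((c * z k : ℝ) : ℂ)) : Matrix d d ℂ)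
      = (c : ℂ) • diagonal (fun k => (z k : ℂ)) := fun c z => by
    rw [← diagonal_smul]
    congr 1
    funext k
    simp
  have hconv : ConvexOn ℝ Set.univ fun z : d → ℝ => N (diagonal (fun k => (z k : ℂ))) := by
    refine ⟨convex_univ, fun z _ z' _ b c hb hc _ => ?_⟩
    have h1 : (diagonal (fun k => ((b • z + c • z') k : ℂ)) : Matrix d d ℂ)
        = (b : ℂ) • diagonal (fun k => (z k : ℂ)) + (c : ℂ) • diagonal (fun k => (z' k : ℂ)) := by
      rw [← hsmul, ← hsmul, diagonal_add]
      simp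
    simp only [smul_eq_mul]
    rw [h1, ← hN.smul_eq b _ hb (hd z), ← hN.smul_eq c _ hc (hd z')]
    refine hN.add_le _ _ ?_ ?_
    · rw [← hsmul]; exact hd fun k => b * z k
    · rw [← hsmul]; exact hd fun k => c * z' k
  obtain ⟨_, ⟨σ, rfl⟩, h⟩ :=
    (hconv.subset (Set.subset_univ _) (convex_convexHull ℝ _)).exists_ge_of_mem_convexHull
      (subset_convexHull ℝ _) hy
  refine h.trans_eq ?_
  obtain ⟨R, hR, hRl⟩ := permMatrix_conj_diagonal σ l
  rw [← hN.conj_eq R _ hR (hd l), hRl]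
  rfl

end

/-! ### Continuous induction in time, then induction on pulses -/

section

theorem add_smul_mem_permutahedron {d : Type*} {l y a : d → ℝ} (hy : y ∈ permutahedron l)
    (ha : a ∈ permutahedron l) {p q : ℝ} (hp : 0 ≤ p) (hq : 0 < q) :
    ∃ y' ∈ permutahedron l, ∀ k, (p + q) * y' k = p * y k + q * a k := by
  have hpq : 0 < p + q := by linarith
  refine ⟨(p / (p + q)) • y + (q / (p + q)) • a,
    convex_convexHull ℝ _ hy ha (by positivity) (by positivity) (by field_simp), fun k => ?_⟩
  simp only [Pi.add_apply, Pi.smul_apply, smul_eq_mul]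
  field_simp

variable {d : Type*} [Fintype d] [DecidableEq d]

/-- If the eigenphases of `W` are `t y` with `y` majorized by the eigenvalues `l` of `A`, then those
of `exp(-iτA) W` are `(t + τ) y'` with `y'` majorized by `l`. The proof is a continuous induction on
the time `s ∈ [0, τ]`, with an error `ε s` in the phases; compactness then gives `ε = 0`. -/
theorem exists_exp_mul_phaseConj_eq {Q : Matrix d d ℂ} (hQ : Q ∈ unitaryGroup d ℂ)
    {V : Matrix d d ℂ} (hV : V ∈ unitaryGroup d ℂ) {l y : d → ℝ} (hy : y ∈ permutahedron l)
    {t τ : ℝ} (ht : 0 ≤ t) (hτ : 0 ≤ τ) :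
    ∃ V' ∈ unitaryGroup d ℂ, ∃ y' ∈ permutahedron l,
      NormedSpace.exp ((-(Complex.I * (τ : ℂ))) • (Q * diagonal (fun k => (l k : ℂ)) * Qᴴ)) *
        phaseConj V (fun k => t * y k) = phaseConj V' (fun k => (t + τ) * y' k) := by
  set A := Q * diagonal (fun k => (l k : ℂ)) * Qᴴ with hAdef
  have hA : A.IsHermitian := isHermitian_conj_diagonal Q l
  set W := phaseConj V (fun k => t * y k) with hW
  let ev : ℝ → Matrix d d ℂ := fun s => NormedSpace.exp ((-(Complex.I * (s : ℂ))) • A)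
  have hev : Continuous ev := by
    have h1 : ev = fun s : ℝ => Q * diagonal (fun k => Complex.exp (-(Complex.I * (s : ℂ)) * l k))
        * Qᴴ := funext fun s => exp_smul_conj_diagonal hQ _ l
    rw [h1]
    fun_prop
  have hev_add : ∀ s s', ev (s + s') = ev s' * ev s := fun s s' => by
    simp only [ev]
    rw [← Matrix.exp_add_of_commute _ _
      (((Commute.refl A).smul_left _).smul_right _), ← add_smul]
    congr 2
    push_cast
    ring
  -- Points are `((s, ε), y, z, V)`, where `ε s z` is the phase error at time `s`. Compactness makes
  -- the set of attainable `(s, ε)` closed, which serves both the limits in `s` and the limit `ε →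
  -- 0`.
  let C : Set ((ℝ × ℝ) × (d → ℝ) × (d → ℝ) × Matrix d d ℂ) :=
    (Set.Icc 0 τ ×ˢ Set.Icc 0 1) ×ˢ permutahedron l ×ˢ Set.Icc (-1) 1 ×ˢ
      {V | V ∈ unitaryGroup d ℂ}
  have hC : IsCompact C :=
    (isCompact_Icc.prod isCompact_Icc).prod ((isCompact_permutahedron l).prod
      (isCompact_Icc.prod isCompact_unitaryGroup))
  let D : Set ((ℝ × ℝ) × (d → ℝ) × (d → ℝ) × Matrix d d ℂ) :=
    {p | ev p.1.1 * W = phaseConj p.2.2.2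
      (fun k => (t + p.1.1) * p.2.1 k + p.1.2 * p.1.1 * p.2.2.1 k)}
  have hD : IsClosed D := by
    refine isClosed_eq ((hev.comp (by fun_prop)).mul continuous_const) ?_
    simp only [phaseConj]
    fun_prop
  have hI : IsClosed (Prod.fst '' (C ∩ D)) := ((hC.inter_right hD).image continuous_fst).isClosed
  have hstep : ∀ ε ∈ Set.Ioc (0 : ℝ) 1, (τ, ε) ∈ Prod.fst '' (C ∩ D) := by
    intro ε hε
    refine IsClosed.mem_of_ge_of_forall_exists_gt (a := 0) (b := τ)
      (s := {s | (s, ε) ∈ Prod.fst '' (C ∩ D)}) ?_ ?_ hτ ?_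
    · exact (hI.preimage (by fun_prop : Continuous fun s : ℝ => (s, ε))).inter isClosed_Icc
    · refine ⟨((0, ε), y, 0, V), ⟨⟨⟨⟨le_rfl, hτ⟩, hε.1.le, hε.2⟩, hy, ⟨?_, ?_⟩, hV⟩, ?_⟩, rfl⟩
      · intro k; simp
      · intro k; simp
      · simp [D, ev, hW]
    · rintro s ⟨⟨⟨p, y₁, z₁, V₁⟩, ⟨⟨-, hy₁, hz₁, hV₁⟩, h1⟩, rfl⟩, hs0, hsτ⟩
      simp only [D, Set.mem_ofPred_eq] at h1
      obtain ⟨U, hU, σ, hU'⟩ := exists_phase_velocity hA hV₁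
        (fun k => (t + s) * y₁ k + ε * s * z₁ k)
      obtain ⟨δ, hδ0, hδ, Q', hQ', r, hr, h2⟩ := hU' ε hε.1 (τ - s) (by linarith)
      -- The new `y` is the time-weighted mean of the old one and the velocity, which is in the hull
      -- by Schur.
      obtain ⟨y₂, hy₂, hy₂'⟩ := add_smul_mem_permutahedron
        (comp_perm_mem_permutahedron hy₁ σ) (re_diag_conj_mem_permutahedron hU hQ l)
        (p := t + s) (by linarith) hδ0
      have hsδ : 0 < s + δ := by linarith
      -- The new error vector is the mean of `z₁ ∘ σ` and `r / ε` with weights `s` and `δ`, so its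
      -- entries stay in `[-1, 1]`.
      refine ⟨s + δ, ⟨((s + δ, ε), y₂,
        fun k => (ε * s * z₁ (σ k) + δ * r k) / (ε * (s + δ)), Q'),
        ⟨⟨⟨⟨hsδ.le, by linarith⟩, hε.1.le, hε.2⟩, hy₂, ⟨?_, ?_⟩, hQ'⟩, ?_⟩, rfl⟩, by linarith,
        by linarith⟩
      · intro k
        have h3 := hz₁.1 (σ k)
        have h4 := (abs_le.1 (hr k)).1
        simp only [Pi.neg_apply, Pi.one_apply] at h3 ⊢
        rw [le_div_iff₀ (mul_pos hε.1 hsδ)]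
        have h5 := mul_le_mul_of_nonneg_left h3 (mul_nonneg hε.1.le hs0)
        have h6 := mul_le_mul_of_nonneg_left h4 hδ0.le
        linarith
      · intro k
        have h3 := hz₁.2 (σ k)
        have h4 := (abs_le.1 (hr k)).2
        simp only [Pi.one_apply] at h3 ⊢
        rw [div_le_iff₀ (mul_pos hε.1 hsδ)]
        have h5 := mul_le_mul_of_nonneg_left h3 (mul_nonneg hε.1.le hs0)
        have h6 := mul_le_mul_of_nonneg_left h4 hδ0.le
        linarith
      · simp only [D, Set.mem_ofPred_eq]
        rw [hev_add, mul_assoc, h1, h2]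
        congr 1
        funext k
        have h3 := hy₂' k
        simp only [Function.comp_apply] at h3
        rw [← add_assoc, h3, mul_div_cancel₀ _ (mul_pos hε.1 hsδ).ne']
        ring
  have h0 : (τ, (0 : ℝ)) ∈ Prod.fst '' (C ∩ D) := by
    refine hI.mem_of_tendsto (b := atTop) (f := fun n : ℕ => (τ, 1 / ((n : ℝ) + 1)))
      (tendsto_const_nhds.prodMk_nhds tendsto_one_div_add_atTop_nhds_zero_nat)
      (Eventually.of_forall fun n => hstep _ ⟨by positivity, ?_⟩)
    rw [div_le_one (by positivity)]
    have : (0 : ℝ) ≤ n := n.cast_nonneg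
    linarith
  obtain ⟨⟨⟨s, ε⟩, y', z, V'⟩, ⟨⟨-, hy', -, hV'⟩, h⟩, hsε⟩ := h0
  obtain ⟨rfl, rfl⟩ := Prod.mk.inj hsε
  refine ⟨V', hV', y', hy', ?_⟩
  simpa only [D, Set.mem_ofPred_eq, zero_mul, add_zero] using h

theorem pulsePropagator_succ {m : ℕ} (P : Fin (m + 2) → Matrix d d ℂ) (τ : Fin (m + 1) → ℝ)
    (H : Matrix d d ℂ) :
    pulsePropagator P τ H = P 0 * NormedSpace.exp ((-(Complex.I * (τ 0 : ℂ))) • H) *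
      pulsePropagator (fun i => P i.succ) (fun i => τ i.succ) H := by
  simp only [pulsePropagator, List.ofFn_succ, List.prod_cons, mul_assoc]
  rfl

theorem idealOperation_succ {n : ℕ} (P : Fin (n + 1) → Matrix d d ℂ) :
    idealOperation P = P 0 * idealOperation (fun i => P i.succ) := by
  simp [idealOperation, List.ofFn_succ]

theorem exists_pulsePropagator_eq {Q : Matrix d d ℂ} (hQ : Q ∈ unitaryGroup d ℂ) (l : d → ℝ)
    (m : ℕ) (P : Fin (m + 1) → Matrix d d ℂ) (hP : ∀ i, P i ∈ unitaryGroup d ℂ)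
    (τ : Fin m → ℝ) (hτ : ∀ i, 0 ≤ τ i) :
    ∃ V ∈ unitaryGroup d ℂ, ∃ y ∈ permutahedron l,
      pulsePropagator P τ (Q * diagonal (fun k => (l k : ℂ)) * Qᴴ) =
        phaseConj V (fun k => (∑ i, τ i) * y k) * idealOperation P := by
  induction m with
  | zero =>
    refine ⟨1, one_mem _, l, self_mem_permutahedron l, ?_⟩
    simp [pulsePropagator, idealOperation, phaseConj]
  | succ m ih =>
    obtain ⟨V, hV, y, hy, h⟩ := ih (fun i => P i.succ) (fun i => hP _) (fun i => τ i.succ)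
      fun i => hτ _
    obtain ⟨V', hV', y', hy', h'⟩ := exists_exp_mul_phaseConj_eq hQ hV hy
      (Finset.sum_nonneg fun i _ => hτ (Fin.succ i)) (hτ 0)
    -- Conjugation by `P 0` changes the eigenbasis but not the phases, and leaves `P 0` on the
    -- right.
    refine ⟨P 0 * V', mul_mem (hP 0) hV', y', hy', ?_⟩
    rw [pulsePropagator_succ, h, idealOperation_succ P, mul_assoc, ← mul_assoc (NormedSpace.exp _),
      h', Fin.sum_univ_succ, add_comm (τ 0)]
    simp only [phaseConj, conjTranspose_mul, mul_assoc]
    rw [← mul_assoc (P 0)ᴴ, conjTranspose_mul_of_mem_unitaryGroup (hP 0), one_mul]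

end

theorem mainTheorem1 {d : Type*} [Fintype d] [DecidableEq d] (m : ℕ)
    (P : Fin (m + 1) → Matrix d d ℂ) (hP : ∀ i, P i ∈ Matrix.unitaryGroup d ℂ)
    (τ : Fin m → ℝ) (hτ : ∀ i, 0 ≤ τ i)
    (H : Matrix d d ℂ) (hH : H.IsHermitian) :
    ∃ H' : Matrix d d ℂ, H'.IsHermitian ∧
      pulsePropagator P τ H =
        NormedSpace.exp ((-(Complex.I * ((∑ i, τ i : ℝ) : ℂ))) • H') * idealOperation P ∧
      ∀ N : Matrix d d ℂ → ℝ, IsUnitarilyInvariantNorm N → N H' ≤ N H := by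
  obtain ⟨Q, hQ, l, rfl⟩ : ∃ Q ∈ unitaryGroup d ℂ, ∃ l : d → ℝ,
      H = Q * diagonal (fun k => (l k : ℂ)) * Qᴴ :=
    ⟨_, hH.eigenvectorUnitary.2, _, IsHermitian.eq_conj_diagonal hH⟩
  obtain ⟨V, hV, y, hy, h⟩ := exists_pulsePropagator_eq hQ l m P hP τ hτ
  refine ⟨V * diagonal (fun k => (y k : ℂ)) * Vᴴ, isHermitian_conj_diagonal V y, ?_,
    fun N hN => hN.conj_diagonal_le hV hQ hy⟩
  rw [exp_smul_conj_diagonal_eq_phaseConj hV, h]
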